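/- Let $M\ge 1$, let $\Omega\subset\mathbb R^M$ be open and bounded, and let $\Omega_1\subset\Omega$ be a nonempty, open, connected set with Lipschitz boundary; $\sigma$ denotes the surface measure on $\partial\Omega_1$. Let $\|u\|_{H^1(\Omega_1)}^2=\int_{\Omega_1}u^2+\int_{\Omega_1}|\nabla u|^2$; boundary values of functions in $H^1(\Omega_1)$ are traces. Let $\gamma>0$, $\tilde\gamma=\min\{1,\gamma\}$, and let $C_F,C_t>0$ be constants such that for all $v\in H^1(\Omega_1)$ $$\|v\|_{H^1(\Omega_1)}^2\le C_F\Big[\int_{\Omega_1}|\nabla v|^2+\int_{\partial\Omega_1}v^2\,d\sigma\Big],\qquad \|v\|_{L^2(\partial\Omega_1)}\le C_t\|v\|_{H^1(\Omega_1)}.$$ Let $f\in L^\infty(\Omega)$, let $\underline a>0$, $\overline a,\overline b\in\mathbb R$ with $\overline b<\underline a\tilde\gamma/C_F$, and let $b\in L^\infty(\Omega)$ with $0<b<\overline b$ a.e. on $\Omega$. Since coefficients are also integrated over $\partial\Omega_1$, let $L^\infty(\Omega)$, as the space of the coefficients $a$ and $h$, denote the essentially bounded functions on $\Omega\cup\partial\Omega_1$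 with respect to Lebesgue measure on $\Omega$ plus $\sigma$, with the essential supremum norm for this measure, and let $$\mathbb A=\{a\in L^\infty(\Omega):\ \underline a<a<\overline a\ \text{ a.e. on }\Omega\text{ and }\sigma\text{-a.e. on }\partial\Omega_1\}.$$ For $a\in\mathbb A$ the Robin problem $-\mathrm{div}(a\nabla u)-bu=f$ in $\Omega_1$, $\nabla u\cdot\vec n+\gamma u=0$ on $\partial\Omega_1$, has a unique weak solution $U(a)\in H^1(\Omega_1)$, i.e. a unique $u=U(a)\in H^1(\Omega_1)$ with $$\int_{\Omega_1}a\nabla u\cdot\nabla v+\int_{\partial\Omega_1}a\gamma uv\,d\sigma-\int_{\Omega_1}buv=\int_{\Omega_1}fv\qquad\text{for all }v\in H^1(\Omega_1).$$ The map $U:\mathbb A\subset L^\infty(\Omega)\to H^1(\Omega_1)$ is continuously Fréchet differentiable: at every $a\in\mathbb A$ it has a (unique) Fréchet derivative relative to $\mathbb A$, a bounded linear operator $U'(a):L^\infty(\Omega)\to H^1(\Omega_1)$, and $a\mapsto U'(a)$ is continuous on $\mathbb A$ in the operator norm. For all $a\in\mathbb A$ and $h\in L^\infty(\Omega)$, $\eta=U'(a)h$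 is the unique weak solution in $H^1(\Omega_1)$ of the linearized Robin problem $-\mathrm{div}(a\nabla\eta)-b\eta=\mathrm{div}(h\nabla U(a))$ in $\Omega_1$, $\nabla\eta\cdot\vec n+\gamma\eta=0$ on $\partial\Omega_1$, i.e. the unique $\eta\in H^1(\Omega_1)$ with $$\int_{\Omega_1}a\nabla\eta\cdot\nabla v+\int_{\partial\Omega_1}a\gamma\eta v\,d\sigma-\int_{\Omega_1}b\eta v=-\int_{\Omega_1}h\nabla U(a)\cdot\nabla v-\int_{\partial\Omega_1}h\gamma U(a)v\,d\sigma\qquad\text{for all }v\in H^1(\Omega_1),$$ and $$\|U'(a)h\|_{H^1(\Omega_1)}\le\frac1{\alpha\beta}\|f\|_{L^2(\Omega)}\|h\|_{L^\infty(\Omega)},\qquad \alpha=\frac{\underline a\tilde\gamma-\overline bC_F}{C_F}>0,\quad \beta=\frac{\underline a\tilde\gamma-\overline bC_F}{C_F(1+\gamma C_t^2)}>0.$$ -/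

import Mathlib

open MeasureTheory Filter Topology
open scoped ENNReal NNReal ContDiff

noncomputable section

namespace RobinID

/-- Euclidean space `ℝ^M`. -/
abbrev E (M : ℕ) : Type := EuclideanSpace ℝ (Fin M)

/-- `Ω` has Lipschitz boundary: near every boundary point, in suitable orthonormal coordinates
(with `ν` the last coordinate direction), `Ω` is the region strictly above the graph of a Lipschitz
function `ψ` of the other coordinates `y - ⟪ν, y⟫ ν`. -/
def HasLipschitzBoundary {M : ℕ} (Ω : Set (E M)) : Prop :=
  ∀ x ∈ frontier Ω, ∃ (ν : E M) (K : ℝ≥0) (ψ : E M → ℝ) (r : ℝ),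
    ‖ν‖ = 1 ∧ 0 < r ∧ LipschitzWith K ψ ∧
      ∀ y ∈ Metric.ball x r, (y ∈ Ω ↔ ψ (y - inner ℝ ν y • ν) < inner ℝ ν y)

/-- Surface measure on `∂Ω`: the (normalized) `(M-1)`-dimensional Hausdorff measure. -/
def surf {M : ℕ} (Ω : Set (E M)) : Measure (E M) :=
  (μHE[M - 1] : Measure (E M)).restrict (frontier Ω)

/-- `L²(Ω) × L²(Ω; ℝ^M)` with its Hilbert norm `(‖u‖² + ‖p‖²)^(1/2)`. -/
abbrev L2Pair {M : ℕ} (Ω : Set (E M)) : Type :=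
  WithLp 2 (Lp ℝ 2 (volume.restrict Ω) × Lp (E M) 2 (volume.restrict Ω))

/-- `p` is the weak gradient of `u` on `Ω`, for `w = (u, p)`. -/
def IsWeakGradPair {M : ℕ} (Ω : Set (E M)) (w : L2Pair Ω) : Prop :=
  ∀ φ : E M → ℝ, ContDiff ℝ ∞ φ → HasCompactSupport φ → tsupport φ ⊆ Ω → ∀ i : Fin M,
    ∫ y in Ω, w.fst y * fderiv ℝ φ y (EuclideanSpace.single i 1)
      = - ∫ y in Ω, w.snd y i * φ y

theorem integrable_fst_mul {M : ℕ} {Ω : Set (E M)} (w : L2Pair Ω) {φ : E M → ℝ}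
    (hφ : ContDiff ℝ ∞ φ) (hc : HasCompactSupport φ) (i : Fin M) :
    Integrable (fun y => w.fst y * fderiv ℝ φ y (EuclideanSpace.single i 1))
      (volume.restrict Ω) := by
  have h1 : MemLp (fun y => w.fst y) 2 (volume.restrict Ω) := Lp.memLp w.fst
  have hcont : Continuous (fun y => fderiv ℝ φ y (EuclideanSpace.single i (1 : ℝ))) :=
    (hφ.continuous_fderiv (by simp)).clm_apply continuous_const
  have hsupp : HasCompactSupport (fun y => fderiv ℝ φ y (EuclideanSpace.single i (1 : ℝ))) :=
    hc.fderiv_apply (𝕜 := ℝ) _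
  have h2 : MemLp (fun y => fderiv ℝ φ y (EuclideanSpace.single i (1 : ℝ))) 2
      (volume.restrict Ω) := (hcont.memLp_of_hasCompactSupport hsupp).restrict Ω
  exact h1.integrable_mul h2

theorem integrable_snd_mul {M : ℕ} {Ω : Set (E M)} (w : L2Pair Ω) {φ : E M → ℝ}
    (hφ : ContDiff ℝ ∞ φ) (hc : HasCompactSupport φ) (i : Fin M) :
    Integrable (fun y => w.snd y i * φ y) (volume.restrict Ω) := by
  have h1 : MemLp (fun y => w.snd y i) 2 (volume.restrict Ω) :=
    (EuclideanSpace.proj (𝕜 := ℝ) i).comp_memLp' (Lp.memLp w.snd)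
  have h2 : MemLp φ 2 (volume.restrict Ω) :=
    (hφ.continuous.memLp_of_hasCompactSupport hc).restrict Ω
  exact h1.integrable_mul h2

/-- The Sobolev space `H¹(Ω)`: the pairs `(u, ∇u)` with `u ∈ L²(Ω)` whose weak gradient `∇u` lies in
`L²(Ω; ℝ^M)`. As a subspace of `L2Pair Ω` it carries the norm
`‖u‖_{H¹} = (‖u‖²_{L²} + ‖∇u‖²_{L²})^(1/2)`. -/
def H1 {M : ℕ} (Ω : Set (E M)) : Submodule ℝ (L2Pair Ω) where
  carrier := {w | IsWeakGradPair Ω w}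
  zero_mem' := by
    intro φ hφ hc hs i
    have h1 : ∫ y in Ω, (0 : L2Pair Ω).fst y * fderiv ℝ φ y (EuclideanSpace.single i 1) = 0 := by
      apply integral_eq_zero_of_ae
      filter_upwards [Lp.coeFn_zero ℝ 2 (volume.restrict Ω)] with y hy
      have : ((0 : L2Pair Ω).fst : E M → ℝ) y = 0 := hy
      rw [this]
      simp
    have h2 : ∫ y in Ω, (0 : L2Pair Ω).snd y i * φ y = 0 := by
      apply integral_eq_zero_of_ae
      filter_upwards [Lp.coeFn_zero (E M) 2 (volume.restrict Ω)] with y hy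
      have : ((0 : L2Pair Ω).snd : E M → E M) y = 0 := hy
      rw [this]
      simp
    rw [h1, h2, neg_zero]
  add_mem' := by
    intro v w hv hw φ hφ hc hs i
    have h1 : ∫ y in Ω, (v + w).fst y * fderiv ℝ φ y (EuclideanSpace.single i 1)
        = ∫ y in Ω, (v.fst y * fderiv ℝ φ y (EuclideanSpace.single i 1)
          + w.fst y * fderiv ℝ φ y (EuclideanSpace.single i 1)) := by
      apply integral_congr_ae
      filter_upwards [Lp.coeFn_add v.fst w.fst] with y hy
      have : ((v + w).fst : E M → ℝ) y = v.fst y + w.fst y := hy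
      rw [this, add_mul]
    have h2 : ∫ y in Ω, (v + w).snd y i * φ y
        = ∫ y in Ω, (v.snd y i * φ y + w.snd y i * φ y) := by
      apply integral_congr_ae
      filter_upwards [Lp.coeFn_add v.snd w.snd] with y hy
      have : ((v + w).snd : E M → E M) y = v.snd y + w.snd y := hy
      rw [this, PiLp.add_apply, add_mul]
    rw [h1, h2, integral_add (integrable_fst_mul v hφ hc i) (integrable_fst_mul w hφ hc i),
      integral_add (integrable_snd_mul v hφ hc i) (integrable_snd_mul w hφ hc i),
      hv φ hφ hc hs i, hw φ hφ hc hs i, neg_add]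
  smul_mem' := by
    intro c w hw φ hφ hc hs i
    have h1 : ∫ y in Ω, (c • w).fst y * fderiv ℝ φ y (EuclideanSpace.single i 1)
        = ∫ y in Ω, c * (w.fst y * fderiv ℝ φ y (EuclideanSpace.single i 1)) := by
      apply integral_congr_ae
      filter_upwards [Lp.coeFn_smul c w.fst] with y hy
      have : ((c • w).fst : E M → ℝ) y = c * w.fst y := hy
      rw [this, mul_assoc]
    have h2 : ∫ y in Ω, (c • w).snd y i * φ y = ∫ y in Ω, c * (w.snd y i * φ y) := by
      apply integral_congr_ae
      filter_upwards [Lp.coeFn_smul c w.snd] with y hy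
      have : ((c • w).snd : E M → E M) y = c • w.snd y := hy
      rw [this, PiLp.smul_apply, smul_eq_mul, mul_assoc]
    rw [h1, h2, integral_const_mul, integral_const_mul, hw φ hφ hc hs i, mul_neg]

/-- The function `u ∈ L²(Ω)` underlying an element of `H¹(Ω)`. -/
def val {M : ℕ} {Ω : Set (E M)} (u : H1 Ω) : Lp ℝ 2 (volume.restrict Ω) := u.1.fst

/-- The weak gradient `∇u ∈ L²(Ω; ℝ^M)` of `u ∈ H¹(Ω)`. -/
def grad {M : ℕ} {Ω : Set (E M)} (u : H1 Ω) : Lp (E M) 2 (volume.restrict Ω) := u.1.snd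

/-- `g ∈ L²(∂Ω)` is the boundary trace `u|_{∂Ω}` of `u ∈ H¹(Ω)`: there are functions `φ n`, smooth up
to the boundary, with `φ n → u` in `H¹(Ω)` and `φ n |_{∂Ω} → g` in `L²(∂Ω)`. On a bounded Lipschitz
domain every `u ∈ H¹(Ω)` has exactly one trace, so there "for all `v` and `g` with `IsTrace v g`" means
"for all `v ∈ H¹(Ω)`, with `g = v|_{∂Ω}`". -/
def IsTrace {M : ℕ} {Ω : Set (E M)} (u : H1 Ω) (g : Lp ℝ 2 (surf Ω)) : Prop :=
  ∃ φ : ℕ → E M → ℝ, (∀ n, ContDiff ℝ ∞ (φ n)) ∧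
    Tendsto (fun n => eLpNorm (fun y => φ n y - val u y) 2 (volume.restrict Ω)) atTop (𝓝 0) ∧
    Tendsto (fun n => eLpNorm (fun y => gradient (φ n) y - grad u y) 2 (volume.restrict Ω))
      atTop (𝓝 0) ∧
    Tendsto (fun n => eLpNorm (fun y => φ n y - g y) 2 (surf Ω)) atTop (𝓝 0)

/-- `C` is a constant in the trace inequality `‖u‖_{L²(∂Ω)} ≤ C ‖u‖_{H¹(Ω)}`. -/
def IsTraceConst {M : ℕ} (Ω : Set (E M)) (C : ℝ) : Prop :=
  0 < C ∧ ∀ (u : H1 Ω) (g : Lp ℝ 2 (surf Ω)), IsTrace u g → ‖g‖ ≤ C * ‖u‖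

/-- `C` is a constant in the Friedrichs inequality
`‖u‖²_{H¹(Ω)} ≤ C (∫_Ω |∇u|² + ∫_{∂Ω} u²)`. -/
def IsFriedrichsConst {M : ℕ} (Ω : Set (E M)) (C : ℝ) : Prop :=
  0 < C ∧ ∀ (u : H1 Ω) (g : Lp ℝ 2 (surf Ω)), IsTrace u g →
    ‖u‖ ^ 2 ≤ C * ((∫ y in Ω, ‖grad u y‖ ^ 2) + ∫ y, (g y) ^ 2 ∂(surf Ω))

/-- Lebesgue measure on `Ω` plus surface measure on `∂Ω₁`. -/
def coefMeasure {M : ℕ} (Ω Ω₁ : Set (E M)) : Measure (E M) :=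
  volume.restrict Ω + surf Ω₁

/-- The coefficient space `L^∞(Ω)`. The Robin problem uses the values of the coefficient in `Ω` and,
through `∫_{∂Ω₁} a γ u v`, on the null set `∂Ω₁`; so coefficients are essentially bounded
functions, identified when they agree almost everywhere in `Ω` and surface-almost everywhere on
`∂Ω₁`, with the corresponding essential supremum norm. -/
abbrev Coef {M : ℕ} (Ω Ω₁ : Set (E M)) : Type := Lp ℝ ∞ (coefMeasure Ω Ω₁)

/-- The admissible set `𝔸` of coefficients `a` with `lo < a < hi` almost everywhere. -/
def admissible {M : ℕ} (Ω Ω₁ : Set (E M)) (lo hi : ℝ) : Set (Coef Ω Ω₁) :=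
  {a | ∀ᵐ x ∂(coefMeasure Ω Ω₁), lo < a x ∧ a x < hi}

/-- `u ∈ H¹(Ω₁)` is a weak solution of `-div(a∇u) - bu = f` in `Ω₁`, `∇u·n + γu = 0` on `∂Ω₁`:
`∫_{Ω₁} a∇u·∇v + ∫_{∂Ω₁} aγuv - ∫_{Ω₁} buv = ∫_{Ω₁} fv` for all `v ∈ H¹(Ω₁)`. Boundary values
of `u` and `v` are their traces `gu`, `gv`. -/
def IsWeakSolution {M : ℕ} {Ω Ω₁ : Set (E M)} (γ : ℝ) (b f : Lp ℝ ∞ (volume.restrict Ω))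
    (a : Coef Ω Ω₁) (u : H1 Ω₁) : Prop :=
  ∃ gu : Lp ℝ 2 (surf Ω₁), IsTrace u gu ∧
    ∀ (v : H1 Ω₁) (gv : Lp ℝ 2 (surf Ω₁)), IsTrace v gv →
      (∫ y in Ω₁, a y * inner ℝ (grad u y) (grad v y))
        + (∫ y, a y * γ * gu y * gv y ∂(surf Ω₁))
        - (∫ y in Ω₁, b y * val u y * val v y)
      = ∫ y in Ω₁, f y * val v y

/-- `η ∈ H¹(Ω₁)` is a weak solution of the linearized Robin problem
`-div(a∇η) - bη = div(h∇u)` in `Ω₁`, `∇η·n + γη = 0` on `∂Ω₁`, where `∇u·n + γu = 0` on `∂Ω₁`: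
`∫_{Ω₁} a∇η·∇v + ∫_{∂Ω₁} aγηv - ∫_{Ω₁} bηv = -∫_{Ω₁} h∇u·∇v - ∫_{∂Ω₁} hγuv` for all
`v ∈ H¹(Ω₁)`. -/
def IsLinearizedSolution {M : ℕ} {Ω Ω₁ : Set (E M)} (γ : ℝ) (b : Lp ℝ ∞ (volume.restrict Ω))
    (a h : Coef Ω Ω₁) (u η : H1 Ω₁) : Prop :=
  ∃ gu gη : Lp ℝ 2 (surf Ω₁), IsTrace u gu ∧ IsTrace η gη ∧
    ∀ (v : H1 Ω₁) (gv : Lp ℝ 2 (surf Ω₁)), IsTrace v gv →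
      (∫ y in Ω₁, a y * inner ℝ (grad η y) (grad v y))
        + (∫ y, a y * γ * gη y * gv y ∂(surf Ω₁))
        - (∫ y in Ω₁, b y * val η y * val v y)
      = - (∫ y in Ω₁, h y * inner ℝ (grad u y) (grad v y))
        - (∫ y, h y * γ * gu y * gv y ∂(surf Ω₁))

open Classical in
/-- The coefficient-to-solution map `U`: the weak solution of the Robin problem with coefficient `a`
(and `0` for coefficients for which there is none). -/
def solMap {M : ℕ} {Ω Ω₁ : Set (E M)} (γ : ℝ) (b f : Lp ℝ ∞ (volume.restrict Ω))
    (a : Coef Ω Ω₁) : H1 Ω₁ :=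
  if hex : ∃ u, IsWeakSolution γ b f a u then hex.choose else 0

end RobinID

end

/-! The proof takes place in the Hilbert space `traceGraph Ω₁` of pairs `(u, g)` with `IsTrace u g`,
a closed subspace of `H¹(Ω₁) × L²(∂Ω₁)`. Test functions in the weak formulations are exactly such
pairs, so the Robin problem becomes a single equation `(L a - K) x = F`, with `L` bounded and linear
in the coefficient (`isWeakSolution_iff`). No existence theorem for traces is needed.

The Friedrichs inequality makes the form coercive in the `H¹` norm with constant `α`
(`le_inner_robinOp_sub`). The trace inequality bounds the graph norm by the `H¹` norm, so
Lax–Milgram makes `L a - K` invertible for every admissible `a` (`isUnit_robinOp_sub`). Inversion is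
smooth on the units of a Banach algebra, hence `a ↦ (L a - K)⁻¹ F` is `C¹` near `a`, and
differentiating the equation gives the linearized problem (`apply_fderiv_paramSol`). The estimate
results from testing twice: the state equation with its solution gives `‖f‖ / α`, and the linearized
equation with its solution gives a further factor `(1 + γ Ct²) ‖h‖ / α = ‖h‖ / β`. -/

noncomputable section

namespace RobinID

/-! ### Linear equations depending affinely on a parameter -/

section AbstractSolution

variable {X V : Type*} [NormedAddCommGroup X] [NormedSpace ℝ X]
  [NormedAddCommGroup V] [InnerProductSpace ℝ V]

/-- The solution `x` of `(L a - K) x = F`, as a function of the parameter `a`. -/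
def paramSol (L : X →L[ℝ] V →L[ℝ] V) (K : V →L[ℝ] V) (F : V) (a : X) : V :=
  Ring.inverse (L a - K) F

variable {L : X →L[ℝ] V →L[ℝ] V} {K : V →L[ℝ] V} {F : V} {a : X}

theorem paramSol_eq (ha : IsUnit (L a - K)) : (L a - K) (paramSol L K F a) = F := by
  have := congrArg (fun S : V →L[ℝ] V => S F) (Ring.mul_inverse_cancel _ ha)
  exact this

theorem eq_of_apply_eq (ha : IsUnit (L a - K)) {x y : V} (h : (L a - K) x = (L a - K) y) :
    x = y := by
  have h2 := congrArg (fun z => Ring.inverse (L a - K) z) h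
  have hx := fun z : V => congrArg (fun S : V →L[ℝ] V => S z) (Ring.inverse_mul_cancel _ ha)
  simp only [mul_apply_eq_comp, one_apply_eq_self] at hx
  rwa [hx, hx] at h2

variable [CompleteSpace V]

/-- An operator on a Hilbert space with coercive quadratic form is invertible (Lax–Milgram). -/
theorem isUnit_of_coercive (T : V →L[ℝ] V) {c : ℝ} (hc : 0 < c)
    (hT : ∀ x, c * ‖x‖ ^ 2 ≤ inner ℝ (T x) x) : IsUnit T := by
  have hco : IsCoercive ((innerSL ℝ).comp T : V →L[ℝ] V →L[ℝ] ℝ) :=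
    ⟨c, hc, fun u => by
      simpa [pow_two, mul_assoc] using hT u⟩
  have hTe : T = (hco.continuousLinearEquivOfBilin : V →L[ℝ] V) := by
    ext v
    exact hco.unique_continuousLinearEquivOfBilin fun w => by simp
  rw [hTe]
  exact ⟨(ContinuousLinearEquiv.unitsEquiv ℝ V).symm hco.continuousLinearEquivOfBilin, rfl⟩

/-- An affine map into the operator algebra is composed with inversion, which is smooth at units,
and with evaluation at `F`. -/
theorem contDiffAt_paramSol (ha : IsUnit (L a - K)) : ContDiffAt ℝ 1 (paramSol L K F) a := by
  have h1 : ContDiffAt ℝ 1 (Ring.inverse : (V →L[ℝ] V) → (V →L[ℝ] V)) (L a - K) := by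
    obtain ⟨u, hu⟩ := ha
    rw [← hu]
    exact contDiffAt_ringInverse ℝ u
  have h2 : ContDiffAt ℝ 1 (fun a => L a - K) a := (L.contDiff.sub contDiff_const).contDiffAt
  exact (h1.comp a h2).clm_apply contDiffAt_const

/-- The product rule is applied to the identity `(L a - K) (S a) = F`, whose right-hand side is
constant. -/
theorem apply_fderiv_paramSol (ha : IsUnit (L a - K)) (h : X) :
    (L a - K) (fderiv ℝ (paramSol L K F) a h) = -(L h (paramSol L K F a)) := by
  have hd : HasFDerivAt (paramSol L K F) (fderiv ℝ (paramSol L K F) a) a :=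
    ((contDiffAt_paramSol ha).differentiableAt (by simp)).hasFDerivAt
  have hT : HasFDerivAt (fun a => L a - K) L a := L.hasFDerivAt.sub_const K
  have hprod := hT.clm_apply hd
  -- Units form an open set, so near `a` the default value `0` of `Ring.inverse` does not occur.
  have hconst : (fun a => (L a - K) (paramSol L K F a)) =ᶠ[𝓝 a] fun _ => F := by
    have hc : ContinuousAt (fun a => L a - K) a := hT.continuousAt
    filter_upwards [hc.eventually (Units.isOpen.mem_nhds ha)] with y hy
    exact paramSol_eq hy
  have h0 := hprod.unique ((hasFDerivAt_const F a).congr_of_eventuallyEq hconst)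
  have := congrArg (fun S : X →L[ℝ] V => S h) h0
  simp only [add_apply, ContinuousLinearMap.comp_apply,
    ContinuousLinearMap.flip_apply, zero_apply] at this
  exact eq_neg_of_add_eq_zero_left this

end AbstractSolution

/-! ### Multiplication of `L²` functions by bounded coefficients -/

section Multiplication

variable {Y F : Type*} [MeasurableSpace Y] [NormedAddCommGroup F] [InnerProductSpace ℝ F]
  {μ ν : Measure Y}

/-- Restriction of `L^p` functions to a smaller measure. -/
def lpMono (G : Type*) [NormedAddCommGroup G] [NormedSpace ℝ G] (p : ℝ≥0∞) [Fact (1 ≤ p)]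
    (h : ν ≤ μ) : Lp G p μ →L[ℝ] Lp G p ν :=
  LinearMap.mkContinuous
    { toFun := fun u => ((Lp.memLp u).mono_measure h).toLp u
      map_add' := fun u v => by
        rw [← MemLp.toLp_add]
        exact MemLp.toLp_congr _ _ ((Measure.absolutelyContinuous_of_le h).ae_le
          (Lp.coeFn_add u v))
      map_smul' := fun c u => by
        rw [RingHom.id_apply, ← MemLp.toLp_const_smul]
        exact MemLp.toLp_congr _ _ ((Measure.absolutelyContinuous_of_le h).ae_le
          (Lp.coeFn_smul c u)) } 1
    fun u => by
      rw [one_mul, LinearMap.coe_mk, AddHom.coe_mk, Lp.norm_toLp, Lp.norm_def]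
      exact ENNReal.toReal_mono (Lp.eLpNorm_ne_top u) (eLpNorm_mono_measure _ h)

theorem coeFn_lpMono {G : Type*} [NormedAddCommGroup G] [NormedSpace ℝ G] {p : ℝ≥0∞}
    [Fact (1 ≤ p)] (h : ν ≤ μ) (u : Lp G p μ) : lpMono G p h u =ᵐ[ν] u :=
  ((Lp.memLp u).mono_measure h).coeFn_toLp

theorem norm_lpMono_le {G : Type*} [NormedAddCommGroup G] [NormedSpace ℝ G] {p : ℝ≥0∞}
    [Fact (1 ≤ p)] (h : ν ≤ μ) (u : Lp G p μ) : ‖lpMono G p h u‖ ≤ ‖u‖ := by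
  simpa using (lpMono G p h).le_of_opNorm_le (LinearMap.mkContinuous_norm_le _ zero_le_one _) u

/-- Multiplication of `L²` functions by `L^∞` functions. -/
def mulL2 (F : Type*) [NormedAddCommGroup F] [InnerProductSpace ℝ F] (μ : Measure Y) :
    Lp ℝ ∞ μ →L[ℝ] Lp F 2 μ →L[ℝ] Lp F 2 μ :=
  (ContinuousLinearMap.lsmul ℝ ℝ).holderL μ ∞ 2 2

theorem coeFn_mulL2 (a : Lp ℝ ∞ μ) (u : Lp F 2 μ) : mulL2 F μ a u =ᵐ[μ] fun y => a y • u y :=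
  ContinuousLinearMap.coeFn_holder (ContinuousLinearMap.lsmul ℝ ℝ : ℝ →L[ℝ] F →L[ℝ] F) a u

theorem norm_mulL2_le (a : Lp ℝ ∞ μ) (u : Lp F 2 μ) : ‖mulL2 F μ a u‖ ≤ ‖a‖ * ‖u‖ := by
  refine (ContinuousLinearMap.norm_holder_apply_apply_le
    (ContinuousLinearMap.lsmul ℝ ℝ : ℝ →L[ℝ] F →L[ℝ] F) a u).trans ?_
  have := ContinuousLinearMap.opNorm_lsmul_le (𝕜 := ℝ) (R := ℝ) (E := F)
  rw [mul_assoc]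
  exact mul_le_of_le_one_left (by positivity) this

theorem inner_mulL2 (a : Lp ℝ ∞ μ) (u v : Lp F 2 μ) :
    inner ℝ (mulL2 F μ a u) v = ∫ y, a y * inner ℝ (u y) (v y) ∂μ := by
  rw [L2.inner_def]
  refine integral_congr_ae ?_
  filter_upwards [coeFn_mulL2 a u] with y hy
  rw [hy, real_inner_smul_left]

theorem inner_mulL2_real (a : Lp ℝ ∞ μ) (u v : Lp ℝ 2 μ) :
    inner ℝ (mulL2 ℝ μ a u) v = ∫ y, a y * u y * v y ∂μ := by
  rw [inner_mulL2]
  refine integral_congr_ae (.of_forall fun y => ?_)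
  simp only [Real.inner_apply]
  ring

theorem abs_inner_mulL2_le (a : Lp ℝ ∞ μ) (u v : Lp F 2 μ) :
    |inner ℝ (mulL2 F μ a u) v| ≤ ‖a‖ * (‖u‖ * ‖v‖) := by
  refine (abs_real_inner_le_norm _ _).trans ?_
  rw [← mul_assoc]
  gcongr
  exact norm_mulL2_le a u

theorem integral_mul_norm_sq_eq (a : Lp ℝ ∞ μ) (u : Lp F 2 μ) :
    inner ℝ (mulL2 F μ a u) u = ∫ y, a y * ‖u y‖ ^ 2 ∂μ := by
  simp [inner_mulL2]

theorem integrable_mul_norm_sq (a : Lp ℝ ∞ μ) (u : Lp F 2 μ) :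
    Integrable (fun y => a y * ‖u y‖ ^ 2) μ := by
  refine (L2.integrable_inner (𝕜 := ℝ) (mulL2 F μ a u) u).congr ?_
  filter_upwards [coeFn_mulL2 a u] with y hy
  rw [hy, real_inner_smul_left, real_inner_self_eq_norm_sq]

theorem norm_sq_eq_integral (u : Lp F 2 μ) : ‖u‖ ^ 2 = ∫ y, ‖u y‖ ^ 2 ∂μ := by
  rw [← real_inner_self_eq_norm_sq, L2.inner_def]
  simp

theorem integrable_norm_sq (u : Lp F 2 μ) : Integrable (fun y => ‖u y‖ ^ 2) μ := by
  simpa using L2.integrable_inner (𝕜 := ℝ) u u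

theorem le_inner_mulL2 {a : Lp ℝ ∞ μ} {c : ℝ} (h : ∀ᵐ y ∂μ, c ≤ a y) (u : Lp F 2 μ) :
    c * ‖u‖ ^ 2 ≤ inner ℝ (mulL2 F μ a u) u := by
  rw [integral_mul_norm_sq_eq, norm_sq_eq_integral, ← integral_const_mul]
  refine integral_mono_ae ((integrable_norm_sq u).const_mul c) (integrable_mul_norm_sq a u) ?_
  filter_upwards [h] with y hy
  exact mul_le_mul_of_nonneg_right hy (by positivity)

theorem inner_mulL2_le {a : Lp ℝ ∞ μ} {c : ℝ} (h : ∀ᵐ y ∂μ, a y ≤ c) (u : Lp F 2 μ) :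
    inner ℝ (mulL2 F μ a u) u ≤ c * ‖u‖ ^ 2 := by
  rw [integral_mul_norm_sq_eq, norm_sq_eq_integral, ← integral_const_mul]
  refine integral_mono_ae (integrable_mul_norm_sq a u) ((integrable_norm_sq u).const_mul c) ?_
  filter_upwards [h] with y hy
  exact mul_le_mul_of_nonneg_right hy (by positivity)

end Multiplication

/-! ### Completeness of `H¹` and of the graph of the trace -/

section Trace

variable {M : ℕ} {Ω : Set (E M)}

/-- For a fixed test function and direction, both sides of the weak-gradient identity are inner
products with fixed `L²` functions. Thus `H1 Ω` is an intersection of closed sets. -/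
theorem isClosed_H1 : IsClosed (H1 Ω : Set (L2Pair Ω)) := by
  have hset : (H1 Ω : Set (L2Pair Ω)) = ⋂ (φ : E M → ℝ) (_ : ContDiff ℝ ∞ φ)
      (_ : HasCompactSupport φ) (_ : tsupport φ ⊆ Ω) (i : Fin M),
      {w : L2Pair Ω | ∫ y in Ω, w.fst y * fderiv ℝ φ y (EuclideanSpace.single i 1)
        = - ∫ y in Ω, w.snd y i * φ y} := by
    ext w
    simp only [Set.mem_iInter]
    rfl
  rw [hset]
  refine isClosed_iInter fun φ => isClosed_iInter fun hφ => isClosed_iInter fun hc =>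
    isClosed_iInter fun _ => isClosed_iInter fun i => ?_
  have hcont : Continuous (fun y => fderiv ℝ φ y (EuclideanSpace.single i (1 : ℝ))) :=
    (hφ.continuous_fderiv (by simp)).clm_apply continuous_const
  have h1 : MemLp (fun y => fderiv ℝ φ y (EuclideanSpace.single i (1 : ℝ))) 2
      (volume.restrict Ω) :=
    (hcont.memLp_of_hasCompactSupport (hc.fderiv_apply (𝕜 := ℝ) _)).restrict Ω
  have h2 : MemLp (fun y => φ y • (EuclideanSpace.single i (1 : ℝ) : E M)) 2
      (volume.restrict Ω) :=
    ((hφ.continuous.smul continuous_const).memLp_of_hasCompactSupport hc.smul_right).restrict Ω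
  refine isClosed_eq ?_ (Continuous.neg ?_)
  · have : (fun w : L2Pair Ω => ∫ y in Ω, w.fst y * fderiv ℝ φ y (EuclideanSpace.single i 1))
        = fun w => inner ℝ (h1.toLp _) w.fst := by
      ext w
      rw [L2.inner_def]
      refine integral_congr_ae ?_
      filter_upwards [h1.coeFn_toLp] with y hy
      rw [hy]
      rfl
    rw [this]
    exact continuous_const.inner (WithLp.prod_continuous_ofLp 2 _ _).fst
  · have : (fun w : L2Pair Ω => ∫ y in Ω, w.snd y i * φ y)
        = fun w => inner ℝ (h2.toLp _) w.snd := by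
      ext w
      rw [L2.inner_def]
      refine integral_congr_ae ?_
      filter_upwards [h2.coeFn_toLp] with y hy
      rw [hy, real_inner_smul_left, EuclideanSpace.inner_single_left]
      simp [mul_comm]
    rw [this]
    exact continuous_const.inner (WithLp.prod_continuous_ofLp 2 _ _).snd

instance : CompleteSpace (H1 Ω) := isClosed_H1.completeSpace_coe

theorem continuous_gradient {φ : E M → ℝ} (hφ : ContDiff ℝ ∞ φ) : Continuous (gradient φ) :=
  (InnerProductSpace.toDual ℝ (E M)).symm.continuous.comp (hφ.continuous_fderiv (by simp))

/-- Replacing sequences by single `ε`-approximants avoids a diagonal argument in the closedness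
proof. -/
theorem isTrace_iff {u : H1 Ω} {g : Lp ℝ 2 (surf Ω)} :
    IsTrace u g ↔ ∀ ε : ℝ≥0∞, 0 < ε → ∃ φ : E M → ℝ, ContDiff ℝ ∞ φ ∧
      eLpNorm (fun y => φ y - val u y) 2 (volume.restrict Ω) < ε ∧
      eLpNorm (fun y => gradient φ y - grad u y) 2 (volume.restrict Ω) < ε ∧
      eLpNorm (fun y => φ y - g y) 2 (surf Ω) < ε := by
  constructor
  · rintro ⟨φ, hφ, h1, h2, h3⟩ ε hε
    obtain ⟨n, hn⟩ := ((h1.eventually (gt_mem_nhds hε)).and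
      ((h2.eventually (gt_mem_nhds hε)).and (h3.eventually (gt_mem_nhds hε)))).exists
    exact ⟨φ n, hφ n, hn.1, hn.2.1, hn.2.2⟩
  · intro h
    -- At `n = 0` the tolerance is `∞`, which is harmless.
    have hpos : ∀ n : ℕ, (0 : ℝ≥0∞) < (n : ℝ≥0∞)⁻¹ := fun n => by simp
    choose φ hφ h1 h2 h3 using fun n : ℕ => h _ (hpos n)
    have hlim := ENNReal.tendsto_inv_nat_nhds_zero
    exact ⟨φ, hφ,
      tendsto_of_tendsto_of_tendsto_of_le_of_le tendsto_const_nhds hlim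
        (fun _ => zero_le) (fun n => (h1 n).le),
      tendsto_of_tendsto_of_tendsto_of_le_of_le tendsto_const_nhds hlim
        (fun _ => zero_le) (fun n => (h2 n).le),
      tendsto_of_tendsto_of_tendsto_of_le_of_le tendsto_const_nhds hlim
        (fun _ => zero_le) (fun n => (h3 n).le)⟩

theorem coeFn_val_add (u v : H1 Ω) : val (u + v) =ᵐ[volume.restrict Ω] val u + val v :=
  Lp.coeFn_add (val u) (val v)

theorem coeFn_grad_add (u v : H1 Ω) : grad (u + v) =ᵐ[volume.restrict Ω] grad u + grad v :=
  Lp.coeFn_add (grad u) (grad v)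

theorem coeFn_val_smul (c : ℝ) (u : H1 Ω) : val (c • u) =ᵐ[volume.restrict Ω] c • ⇑(val u) :=
  Lp.coeFn_smul c (val u)

theorem coeFn_grad_smul (c : ℝ) (u : H1 Ω) : grad (c • u) =ᵐ[volume.restrict Ω] c • ⇑(grad u) :=
  Lp.coeFn_smul c (grad u)

theorem eLpNorm_sub_add_le {Y G : Type*} [MeasurableSpace Y] [NormedAddCommGroup G]
    {μ : Measure Y} {φ ψ : Y → G} {u v w : Lp G 2 μ}
    (hφ : AEStronglyMeasurable φ μ) (hψ : AEStronglyMeasurable ψ μ)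
    (hw : w =ᵐ[μ] u + v) :
    eLpNorm (fun y => (φ y + ψ y) - w y) 2 μ
      ≤ eLpNorm (fun y => φ y - u y) 2 μ + eLpNorm (fun y => ψ y - v y) 2 μ := by
  refine (eLpNorm_congr_ae ?_).trans_le (eLpNorm_add_le
    (hφ.sub (Lp.aestronglyMeasurable u)) (hψ.sub (Lp.aestronglyMeasurable v)) one_le_two)
  filter_upwards [hw] with y hy
  simp only [hy, Pi.add_apply]
  abel

theorem eLpNorm_smul_sub {Y G : Type*} [MeasurableSpace Y] [NormedAddCommGroup G]
    [NormedSpace ℝ G] {μ : Measure Y} {φ : Y → G} {u w : Lp G 2 μ} {c : ℝ}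
    (hw : w =ᵐ[μ] c • ⇑u) :
    eLpNorm (fun y => c • φ y - w y) 2 μ = ‖c‖ₑ * eLpNorm (fun y => φ y - u y) 2 μ := by
  rw [← eLpNorm_const_smul]
  refine eLpNorm_congr_ae ?_
  filter_upwards [hw] with y hy
  simp [hy, smul_sub]

theorem gradient_add' {φ ψ : E M → ℝ} (hφ : ContDiff ℝ ∞ φ) (hψ : ContDiff ℝ ∞ ψ) (y : E M) :
    gradient (fun y => φ y + ψ y) y = gradient φ y + gradient ψ y := by
  unfold gradient
  rw [fderiv_fun_add (hφ.differentiable (by simp) y) (hψ.differentiable (by simp) y), map_add]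

theorem gradient_const_smul' {φ : E M → ℝ} (hφ : ContDiff ℝ ∞ φ) (c : ℝ) (y : E M) :
    gradient (fun y => c • φ y) y = c • gradient φ y := by
  unfold gradient
  rw [fderiv_fun_const_smul (hφ.differentiable (by simp) y), map_smul]

theorem IsTrace.add {u v : H1 Ω} {g k : Lp ℝ 2 (surf Ω)} (hu : IsTrace u g) (hv : IsTrace v k) :
    IsTrace (u + v) (g + k) := by
  obtain ⟨φ, hφ, h1, h2, h3⟩ := hu
  obtain ⟨ψ, hψ, k1, k2, k3⟩ := hv
  refine ⟨fun n y => φ n y + ψ n y, fun n => (hφ n).add (hψ n), ?_, ?_, ?_⟩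
  · refine tendsto_of_tendsto_of_tendsto_of_le_of_le tendsto_const_nhds
      (by simpa using h1.add k1) (fun _ => zero_le) fun n => ?_
    exact eLpNorm_sub_add_le (hφ n).continuous.aestronglyMeasurable
      (hψ n).continuous.aestronglyMeasurable (coeFn_val_add u v)
  · refine tendsto_of_tendsto_of_tendsto_of_le_of_le tendsto_const_nhds
      (by simpa using h2.add k2) (fun _ => zero_le) fun n => ?_
    simp only [gradient_add' (hφ n) (hψ n)]
    exact eLpNorm_sub_add_le (continuous_gradient (hφ n)).aestronglyMeasurable
      (continuous_gradient (hψ n)).aestronglyMeasurable (coeFn_grad_add u v)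
  · refine tendsto_of_tendsto_of_tendsto_of_le_of_le tendsto_const_nhds
      (by simpa using h3.add k3) (fun _ => zero_le) fun n => ?_
    exact eLpNorm_sub_add_le (hφ n).continuous.aestronglyMeasurable
      (hψ n).continuous.aestronglyMeasurable (Lp.coeFn_add g k)

theorem IsTrace.smul {u : H1 Ω} {g : Lp ℝ 2 (surf Ω)} (c : ℝ) (hu : IsTrace u g) :
    IsTrace (c • u) (c • g) := by
  obtain ⟨φ, hφ, h1, h2, h3⟩ := hu
  have key : ∀ {s : ℕ → ℝ≥0∞}, Tendsto s atTop (𝓝 0) →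
      Tendsto (fun n => ‖c‖ₑ * s n) atTop (𝓝 0) := fun hs => by
    simpa using ENNReal.Tendsto.const_mul hs (Or.inr enorm_ne_top)
  refine ⟨fun n y => c • φ n y, fun n => (hφ n).const_smul c, ?_, ?_, ?_⟩
  · simpa only [eLpNorm_smul_sub (coeFn_val_smul c u)] using key h1
  · simp only [gradient_const_smul' (hφ _)]
    simpa only [eLpNorm_smul_sub (coeFn_grad_smul c u)] using key h2
  · simpa only [eLpNorm_smul_sub (Lp.coeFn_smul c g)] using key h3

theorem isTrace_zero : IsTrace (0 : H1 Ω) 0 := by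
  refine ⟨fun _ _ => 0, fun _ => contDiff_const, ?_, ?_, ?_⟩
  · refine tendsto_const_nhds.congr fun _ => ((eLpNorm_congr_ae ?_).trans eLpNorm_zero).symm
    filter_upwards [Lp.coeFn_zero ℝ 2 (volume.restrict Ω)] with y hy
    have : (val (0 : H1 Ω) : E M → ℝ) y = 0 := hy
    simp [this]
  · refine tendsto_const_nhds.congr fun _ => ((eLpNorm_congr_ae ?_).trans eLpNorm_zero).symm
    filter_upwards [Lp.coeFn_zero (E M) 2 (volume.restrict Ω)] with y hy
    have : (grad (0 : H1 Ω) : E M → E M) y = 0 := hy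
    simp [this, gradient]
  · refine tendsto_const_nhds.congr fun _ => ((eLpNorm_congr_ae ?_).trans eLpNorm_zero).symm
    filter_upwards [Lp.coeFn_zero ℝ 2 (surf Ω)] with y hy
    rw [hy]
    simp

/-- The Hilbert space `H¹(Ω) × L²(∂Ω)`. -/
def BulkBoundary (Ω : Set (E M)) : Type := WithLp 2 (H1 Ω × Lp ℝ 2 (surf Ω))

instance : NormedAddCommGroup (BulkBoundary Ω) :=
  inferInstanceAs (NormedAddCommGroup (WithLp 2 (H1 Ω × Lp ℝ 2 (surf Ω))))

instance : InnerProductSpace ℝ (BulkBoundary Ω) :=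
  inferInstanceAs (InnerProductSpace ℝ (WithLp 2 (H1 Ω × Lp ℝ 2 (surf Ω))))

instance : CompleteSpace (BulkBoundary Ω) :=
  inferInstanceAs (CompleteSpace (WithLp 2 (H1 Ω × Lp ℝ 2 (surf Ω))))

namespace BulkBoundary

/-- The projection to `H¹(Ω)`. -/
def bulk (Ω : Set (E M)) : BulkBoundary Ω →L[ℝ] H1 Ω :=
  WithLp.fstL 2 ℝ (H1 Ω) (Lp ℝ 2 (surf Ω))

/-- The projection to `L²(∂Ω)`. -/
def boundary (Ω : Set (E M)) : BulkBoundary Ω →L[ℝ] Lp ℝ 2 (surf Ω) :=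
  WithLp.sndL 2 ℝ (H1 Ω) (Lp ℝ 2 (surf Ω))

theorem exists_eq (u : H1 Ω) (g : Lp ℝ 2 (surf Ω)) :
    ∃ w : BulkBoundary Ω, bulk Ω w = u ∧ boundary Ω w = g :=
  ⟨(WithLp.toLp 2 (u, g) : WithLp 2 (H1 Ω × Lp ℝ 2 (surf Ω))), rfl, rfl⟩

theorem norm_sq (w : BulkBoundary Ω) : ‖w‖ ^ 2 = ‖bulk Ω w‖ ^ 2 + ‖boundary Ω w‖ ^ 2 :=
  WithLp.prod_norm_sq_eq_of_L2 (α := H1 Ω) (β := Lp ℝ 2 (surf Ω)) w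

end BulkBoundary

/-- The graph of the trace operator. -/
def traceGraph (Ω : Set (E M)) : Submodule ℝ (BulkBoundary Ω) where
  carrier := {w | IsTrace (BulkBoundary.bulk Ω w) (BulkBoundary.boundary Ω w)}
  zero_mem' := by
    rw [Set.mem_ofPred_eq, map_zero, map_zero]
    exact isTrace_zero
  add_mem' := fun hu hv => by
    rw [Set.mem_ofPred_eq, map_add, map_add]
    exact IsTrace.add hu hv
  smul_mem' := fun c _ h => by
    rw [Set.mem_ofPred_eq, map_smul, map_smul]
    exact IsTrace.smul c h

theorem eLpNorm_sub_le_add {Y G : Type*} [MeasurableSpace Y] [NormedAddCommGroup G]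
    {μ : Measure Y} {φ : Y → G} (hφ : AEStronglyMeasurable φ μ) (u v : Lp G 2 μ) :
    eLpNorm (fun y => φ y - u y) 2 μ ≤ eLpNorm (fun y => φ y - v y) 2 μ + edist v u := by
  rw [Lp.edist_def]
  refine (eLpNorm_congr_ae (.of_forall fun y => ?_)).trans_le (eLpNorm_add_le
    (hφ.sub (Lp.aestronglyMeasurable v))
    ((Lp.aestronglyMeasurable v).sub (Lp.aestronglyMeasurable u)) one_le_two)
  simp

theorem continuous_val : Continuous (val : H1 Ω → _) :=
  (WithLp.prod_continuous_ofLp 2 _ _).fst.comp continuous_subtype_val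

theorem continuous_grad : Continuous (grad : H1 Ω → _) :=
  (WithLp.prod_continuous_ofLp 2 _ _).snd.comp continuous_subtype_val

/-- A smooth function that approximates a nearby element of the graph within `ε / 2` in all three
norms approximates the limit point within `ε`. Closedness makes the graph a Hilbert space, as
Lax–Milgram requires. -/
theorem isClosed_traceGraph : IsClosed (traceGraph Ω : Set (BulkBoundary Ω)) := by
  rw [← closure_subset_iff_isClosed]
  intro w hw
  refine isTrace_iff.2 fun ε hε => ?_
  have hε2 : 0 < ε / 2 := ENNReal.half_pos hε.ne'
  have hfst := (BulkBoundary.bulk Ω).continuous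
  have hsnd := (BulkBoundary.boundary Ω).continuous
  have n1 : ∀ᶠ z in 𝓝 w, edist (val (BulkBoundary.bulk Ω z)) (val (BulkBoundary.bulk Ω w)) < ε / 2 :=
    (continuous_val.comp hfst).continuousAt.eventually (Metric.eball_mem_nhds _ hε2)
  have n2 : ∀ᶠ z in 𝓝 w, edist (grad (BulkBoundary.bulk Ω z)) (grad (BulkBoundary.bulk Ω w)) < ε / 2 :=
    (continuous_grad.comp hfst).continuousAt.eventually (Metric.eball_mem_nhds _ hε2)
  have n3 : ∀ᶠ z in 𝓝 w, edist (BulkBoundary.boundary Ω z) (BulkBoundary.boundary Ω w) < ε / 2 :=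
    hsnd.continuousAt.eventually (Metric.eball_mem_nhds _ hε2)
  obtain ⟨z, hz, d1, d2, d3⟩ :=
    ((mem_closure_iff_frequently.1 hw).and_eventually (n1.and (n2.and n3))).exists
  obtain ⟨φ, hφ, e1, e2, e3⟩ := isTrace_iff.1 hz (ε / 2) hε2
  have hlt : ∀ {s t : ℝ≥0∞}, s < ε / 2 → t < ε / 2 → s + t < ε := fun hs ht =>
    (ENNReal.add_lt_add hs ht).trans_eq (ENNReal.add_halves ε)
  exact ⟨φ, hφ,
    (eLpNorm_sub_le_add hφ.continuous.aestronglyMeasurable _ _).trans_lt (hlt e1 d1),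
    (eLpNorm_sub_le_add (continuous_gradient hφ).aestronglyMeasurable _ _).trans_lt (hlt e2 d2),
    (eLpNorm_sub_le_add hφ.continuous.aestronglyMeasurable _ _).trans_lt (hlt e3 d3)⟩

instance : CompleteSpace (traceGraph Ω) := isClosed_traceGraph.completeSpace_coe

end Trace

/-! ### Operators representing pulled-back bilinear forms -/

section Pullback

variable {V H : Type*} [NormedAddCommGroup V] [InnerProductSpace ℝ V] [CompleteSpace V]
  [NormedAddCommGroup H] [InnerProductSpace ℝ H] [CompleteSpace H]

/-- The operator `P* S P` representing the form `⟪S (P x), P y⟫`. -/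
def pullback (P : V →L[ℝ] H) : (H →L[ℝ] H) →L[ℝ] (V →L[ℝ] V) :=
  (ContinuousLinearMap.compL ℝ V H V (ContinuousLinearMap.adjoint P)).comp
    ((ContinuousLinearMap.compL ℝ V H H).flip P)

theorem inner_pullback (P : V →L[ℝ] H) (S : H →L[ℝ] H) (x y : V) :
    inner ℝ (pullback P S x) y = inner ℝ (S (P x)) (P y) :=
  ContinuousLinearMap.adjoint_inner_left P y (S (P x))

end Pullback

/-! ### The Robin form on the trace graph: representation, coercivity and bounds -/

section Robin

variable {M : ℕ} {Ω Ω₁ : Set (E M)}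

theorem restrict_le_coefMeasure (hsub : Ω₁ ⊆ Ω) : volume.restrict Ω₁ ≤ coefMeasure Ω Ω₁ :=
  (Measure.restrict_mono hsub le_rfl).trans (Measure.le_add_right le_rfl)

theorem surf_le_coefMeasure : surf Ω₁ ≤ coefMeasure Ω Ω₁ := Measure.le_add_left le_rfl

theorem norm_sq_H1 (u : H1 Ω₁) : ‖u‖ ^ 2 = ‖val u‖ ^ 2 + ‖grad u‖ ^ 2 :=
  WithLp.prod_norm_sq_eq_of_L2 u.1

theorem norm_val_le (u : H1 Ω₁) : ‖val u‖ ≤ ‖u‖ :=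
  pow_le_pow_iff_left₀ (norm_nonneg _) (norm_nonneg _) two_ne_zero |>.1
    (by rw [norm_sq_H1 u]; nlinarith [sq_nonneg ‖grad u‖])

theorem norm_grad_le (u : H1 Ω₁) : ‖grad u‖ ≤ ‖u‖ :=
  pow_le_pow_iff_left₀ (norm_nonneg _) (norm_nonneg _) two_ne_zero |>.1
    (by rw [norm_sq_H1 u]; nlinarith [sq_nonneg ‖val u‖])

/-- The function in `H¹` of an element of the graph of the trace operator. -/
def graphFun (Ω₁ : Set (E M)) : traceGraph Ω₁ →L[ℝ] H1 Ω₁ :=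
  (BulkBoundary.bulk Ω₁).comp (traceGraph Ω₁).subtypeL

/-- The boundary values of an element of the graph of the trace operator. -/
def graphTrace (Ω₁ : Set (E M)) : traceGraph Ω₁ →L[ℝ] Lp ℝ 2 (surf Ω₁) :=
  (BulkBoundary.boundary Ω₁).comp (traceGraph Ω₁).subtypeL

/-- The `L²` function of an element of the graph of the trace operator. -/
def graphVal (Ω₁ : Set (E M)) : traceGraph Ω₁ →L[ℝ] Lp ℝ 2 (volume.restrict Ω₁) :=
  ((WithLp.fstL 2 ℝ _ _).comp (H1 Ω₁).subtypeL).comp (graphFun Ω₁)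

/-- The weak gradient of an element of the graph of the trace operator. -/
def graphGrad (Ω₁ : Set (E M)) : traceGraph Ω₁ →L[ℝ] Lp (E M) 2 (volume.restrict Ω₁) :=
  ((WithLp.sndL 2 ℝ _ _).comp (H1 Ω₁).subtypeL).comp (graphFun Ω₁)

theorem graphVal_apply (x : traceGraph Ω₁) : graphVal Ω₁ x = val (graphFun Ω₁ x) := rfl

theorem graphGrad_apply (x : traceGraph Ω₁) : graphGrad Ω₁ x = grad (graphFun Ω₁ x) := rfl

theorem isTrace_graph (x : traceGraph Ω₁) : IsTrace (graphFun Ω₁ x) (graphTrace Ω₁ x) := x.2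

theorem IsTrace.exists_graph {u : H1 Ω₁} {g : Lp ℝ 2 (surf Ω₁)} (h : IsTrace u g) :
    ∃ x : traceGraph Ω₁, graphFun Ω₁ x = u ∧ graphTrace Ω₁ x = g := by
  obtain ⟨w, rfl, rfl⟩ := BulkBoundary.exists_eq u g
  exact ⟨⟨w, h⟩, rfl, rfl⟩

theorem norm_sq_graph (x : traceGraph Ω₁) :
    ‖x‖ ^ 2 = ‖graphFun Ω₁ x‖ ^ 2 + ‖graphTrace Ω₁ x‖ ^ 2 :=
  BulkBoundary.norm_sq x.1

/-- The operator of the form `∫ a ∇u·∇v + γ ∫ a u v dσ`, linear in the coefficient `a`. -/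
def robinOp (hsub : Ω₁ ⊆ Ω) (γ : ℝ) :
    Coef Ω Ω₁ →L[ℝ] traceGraph Ω₁ →L[ℝ] traceGraph Ω₁ :=
  (pullback (graphGrad Ω₁)).comp
      ((mulL2 (E M) _).comp (lpMono ℝ ∞ (restrict_le_coefMeasure hsub)))
    + γ • (pullback (graphTrace Ω₁)).comp
      ((mulL2 ℝ _).comp (lpMono ℝ ∞ surf_le_coefMeasure))

/-- The operator of the form `∫ b u v`. -/
def massOp (hsub : Ω₁ ⊆ Ω) (b : Lp ℝ ∞ (volume.restrict Ω)) :
    traceGraph Ω₁ →L[ℝ] traceGraph Ω₁ :=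
  pullback (graphVal Ω₁) (mulL2 ℝ _ (lpMono ℝ ∞ (Measure.restrict_mono hsub le_rfl) b))

/-- The restriction to `Ω₁` of a function in `L²(Ω)`, as a load functional. -/
def load (hsub : Ω₁ ⊆ Ω) (f : Lp ℝ 2 (volume.restrict Ω)) : traceGraph Ω₁ :=
  ContinuousLinearMap.adjoint (graphVal Ω₁) (lpMono ℝ 2 (Measure.restrict_mono hsub le_rfl) f)

theorem inner_robinOp' (hsub : Ω₁ ⊆ Ω) (γ : ℝ) (a : Coef Ω Ω₁) (x y : traceGraph Ω₁) :
    inner ℝ (robinOp hsub γ a x) y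
      = inner ℝ (mulL2 (E M) _ (lpMono ℝ ∞ (restrict_le_coefMeasure hsub) a) (graphGrad Ω₁ x))
          (graphGrad Ω₁ y)
        + γ * inner ℝ (mulL2 ℝ _ (lpMono ℝ ∞ surf_le_coefMeasure a) (graphTrace Ω₁ x))
          (graphTrace Ω₁ y) := by
  simp only [robinOp, add_apply, smul_apply, ContinuousLinearMap.comp_apply, inner_add_left,
    real_inner_smul_left, inner_pullback]

theorem inner_robinOp (hsub : Ω₁ ⊆ Ω) (γ : ℝ) (a : Coef Ω Ω₁) (x y : traceGraph Ω₁) :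
    inner ℝ (robinOp hsub γ a x) y
      = (∫ z in Ω₁, a z * inner ℝ (grad (graphFun Ω₁ x) z) (grad (graphFun Ω₁ y) z))
        + ∫ z, a z * γ * graphTrace Ω₁ x z * graphTrace Ω₁ y z ∂(surf Ω₁) := by
  rw [inner_robinOp', inner_mulL2, inner_mulL2_real, ← integral_const_mul]
  congr 1
  · refine integral_congr_ae ?_
    filter_upwards [coeFn_lpMono (restrict_le_coefMeasure hsub) a] with z hz
    rw [hz]
    rfl
  · refine integral_congr_ae ?_
    filter_upwards [coeFn_lpMono surf_le_coefMeasure a] with z hz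
    rw [hz]
    ring

theorem inner_massOp (hsub : Ω₁ ⊆ Ω) (b : Lp ℝ ∞ (volume.restrict Ω)) (x y : traceGraph Ω₁) :
    inner ℝ (massOp hsub b x) y
      = ∫ z in Ω₁, b z * val (graphFun Ω₁ x) z * val (graphFun Ω₁ y) z := by
  rw [massOp, inner_pullback, inner_mulL2_real]
  refine integral_congr_ae ?_
  filter_upwards [coeFn_lpMono (Measure.restrict_mono hsub le_rfl) b] with z hz
  rw [hz]
  rfl

theorem inner_load (hsub : Ω₁ ⊆ Ω) (f : Lp ℝ 2 (volume.restrict Ω)) (y : traceGraph Ω₁) :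
    inner ℝ (load hsub f) y = ∫ z in Ω₁, f z * val (graphFun Ω₁ y) z := by
  rw [load, ContinuousLinearMap.adjoint_inner_left, L2.inner_def]
  refine integral_congr_ae ?_
  filter_upwards [coeFn_lpMono (Measure.restrict_mono hsub le_rfl) f] with z hz
  rw [hz, Real.inner_apply]
  rfl

/-- Pairs `(v, gv)` with `IsTrace v gv` are all the vectors of the Hilbert space, so the variational
identity is an equality of vectors. The `L²` representative `f₂` of `f` is what makes the load a
Riesz vector. -/
theorem isWeakSolution_iff (hsub : Ω₁ ⊆ Ω) {γ : ℝ} {b f : Lp ℝ ∞ (volume.restrict Ω)}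
    {f₂ : Lp ℝ 2 (volume.restrict Ω)} (hf : f₂ =ᵐ[volume.restrict Ω] f) {a : Coef Ω Ω₁}
    {u : H1 Ω₁} :
    IsWeakSolution γ b f a u ↔ ∃ x : traceGraph Ω₁, graphFun Ω₁ x = u ∧
      (robinOp hsub γ a - massOp hsub b) x = load hsub f₂ := by
  have hload : ∀ y : traceGraph Ω₁,
      inner ℝ (load hsub f₂) y = ∫ z in Ω₁, f z * val (graphFun Ω₁ y) z := fun y => by
    rw [inner_load]
    refine integral_congr_ae ?_
    filter_upwards [(Measure.absolutelyContinuous_of_le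
      (Measure.restrict_mono hsub le_rfl)).ae_le hf] with z hz
    rw [hz]
  constructor
  · rintro ⟨gu, hgu, h⟩
    obtain ⟨x, rfl, rfl⟩ := hgu.exists_graph
    refine ⟨x, rfl, ext_inner_right ℝ fun y => ?_⟩
    rw [sub_apply, inner_sub_left, inner_robinOp, inner_massOp, hload]
    exact h _ _ (isTrace_graph y)
  · rintro ⟨x, rfl, hx⟩
    refine ⟨_, isTrace_graph x, fun v gv hv => ?_⟩
    obtain ⟨y, rfl, rfl⟩ := hv.exists_graph
    rw [← hload, ← hx, sub_apply, inner_sub_left, inner_robinOp, inner_massOp]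

/-- The difference `g - k` is a trace of `0`, so the trace inequality forces it to vanish. -/
theorem IsTrace.unique {C : ℝ} (hC : IsTraceConst Ω₁ C) {u : H1 Ω₁}
    {g k : Lp ℝ 2 (surf Ω₁)} (hg : IsTrace u g) (hk : IsTrace u k) : g = k := by
  have h := hC.2 _ _ (hg.add (hk.smul (-1)))
  have h0 : u + (-1 : ℝ) • u = 0 := by simp
  rw [h0, norm_zero, mul_zero] at h
  have h1 := norm_le_zero_iff.1 h
  rwa [neg_one_smul, ← sub_eq_add_neg, sub_eq_zero] at h1

/-- As for the state equation, except that `IsLinearizedSolution` quantifies the trace of `u`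
existentially; uniqueness of traces identifies it with the boundary component of `x`. -/
theorem isLinearizedSolution_iff (hsub : Ω₁ ⊆ Ω) {C : ℝ} (hC : IsTraceConst Ω₁ C) {γ : ℝ}
    {b : Lp ℝ ∞ (volume.restrict Ω)} {a h : Coef Ω Ω₁} (x : traceGraph Ω₁) {η : H1 Ω₁} :
    IsLinearizedSolution γ b a h (graphFun Ω₁ x) η ↔ ∃ z : traceGraph Ω₁, graphFun Ω₁ z = η ∧
      (robinOp hsub γ a - massOp hsub b) z = -(robinOp hsub γ h x) := by
  constructor
  · rintro ⟨gu, gη, hgu, hgη, hv⟩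
    obtain rfl := (isTrace_graph x).unique hC hgu
    obtain ⟨z, rfl, rfl⟩ := hgη.exists_graph
    refine ⟨z, rfl, ext_inner_right ℝ fun y => ?_⟩
    rw [sub_apply, inner_sub_left, inner_neg_left, inner_robinOp, inner_robinOp, inner_massOp,
      neg_add']
    exact hv _ _ (isTrace_graph y)
  · rintro ⟨z, rfl, hz⟩
    refine ⟨_, _, isTrace_graph x, isTrace_graph z, fun v gv hv => ?_⟩
    obtain ⟨y, rfl, rfl⟩ := hv.exists_graph
    have := congrArg (fun w => inner ℝ w y) hz
    rwa [sub_apply, inner_sub_left, inner_neg_left, inner_robinOp, inner_robinOp, inner_massOp,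
      neg_add'] at this

/-- The weights `lo` on the gradient and `γ lo` on the boundary are both at least `lo * min 1 γ`, so
the Friedrichs inequality bounds the principal part below. The mass term costs at most `bmax * ‖u‖²`
in the `H¹` norm, where `0 ≤ bmax` is used. -/
theorem le_inner_robinOp_sub (hsub : Ω₁ ⊆ Ω) {γ lo hi bmax CF : ℝ} (hγ : 0 < γ) (hlo : 0 < lo)
    (hCF : IsFriedrichsConst Ω₁ CF) (hbmax : 0 ≤ bmax) {b : Lp ℝ ∞ (volume.restrict Ω)}
    (hb : ∀ᵐ x ∂(volume.restrict Ω), b x ≤ bmax) {a : Coef Ω Ω₁}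
    (ha : a ∈ admissible Ω Ω₁ lo hi) (x : traceGraph Ω₁) :
    (lo * min 1 γ - bmax * CF) / CF * ‖graphFun Ω₁ x‖ ^ 2
      ≤ inner ℝ ((robinOp hsub γ a - massOp hsub b) x) x := by
  have hbulk : lo * ‖graphGrad Ω₁ x‖ ^ 2 ≤ inner ℝ
      (mulL2 (E M) _ (lpMono ℝ ∞ (restrict_le_coefMeasure hsub) a) (graphGrad Ω₁ x))
      (graphGrad Ω₁ x) := by
    refine le_inner_mulL2 ?_ _
    filter_upwards [coeFn_lpMono (restrict_le_coefMeasure hsub) a,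
      (Measure.absolutelyContinuous_of_le (restrict_le_coefMeasure hsub)).ae_le ha] with z h1 h2
    rw [h1]
    exact h2.1.le
  have hbdry : lo * ‖graphTrace Ω₁ x‖ ^ 2 ≤ inner ℝ
      (mulL2 ℝ _ (lpMono ℝ ∞ surf_le_coefMeasure a) (graphTrace Ω₁ x)) (graphTrace Ω₁ x) := by
    refine le_inner_mulL2 ?_ _
    filter_upwards [coeFn_lpMono surf_le_coefMeasure a,
      (Measure.absolutelyContinuous_of_le surf_le_coefMeasure).ae_le ha] with z h1 h2
    rw [h1]
    exact h2.1.le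
  have hmass : inner ℝ (massOp hsub b x) x ≤ bmax * ‖graphVal Ω₁ x‖ ^ 2 := by
    rw [massOp, inner_pullback]
    refine inner_mulL2_le ?_ _
    filter_upwards [coeFn_lpMono (Measure.restrict_mono hsub le_rfl) b,
      (Measure.absolutelyContinuous_of_le (Measure.restrict_mono hsub le_rfl)).ae_le hb]
      with z h1 h2
    rwa [h1]
  have hF : ‖graphFun Ω₁ x‖ ^ 2 ≤ CF * (‖graphGrad Ω₁ x‖ ^ 2 + ‖graphTrace Ω₁ x‖ ^ 2) := by
    have := hCF.2 _ _ (isTrace_graph x)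
    rw [norm_sq_eq_integral (graphGrad Ω₁ x), norm_sq_eq_integral (graphTrace Ω₁ x)]
    simpa only [Real.norm_eq_abs, sq_abs, graphGrad_apply] using this
  have hval : ‖graphVal Ω₁ x‖ ^ 2 ≤ ‖graphFun Ω₁ x‖ ^ 2 := by
    have := norm_val_le (graphFun Ω₁ x)
    rw [graphVal_apply]
    gcongr
  have hm0 : 0 < min 1 γ := lt_min one_pos hγ
  have h1 : lo * min 1 γ * ‖graphGrad Ω₁ x‖ ^ 2 ≤ lo * ‖graphGrad Ω₁ x‖ ^ 2 := by
    gcongr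
    exact mul_le_of_le_one_right hlo.le (min_le_left _ _)
  have h2 : lo * min 1 γ * ‖graphTrace Ω₁ x‖ ^ 2 ≤ γ * (lo * ‖graphTrace Ω₁ x‖ ^ 2) := by
    rw [← mul_assoc, mul_comm γ lo]
    gcongr
    exact min_le_right _ _
  have h3 : lo * min 1 γ / CF * ‖graphFun Ω₁ x‖ ^ 2
      ≤ lo * min 1 γ * (‖graphGrad Ω₁ x‖ ^ 2 + ‖graphTrace Ω₁ x‖ ^ 2) := by
    rw [div_mul_eq_mul_div, div_le_iff₀ hCF.1]
    calc _ ≤ lo * min 1 γ * (CF * (‖graphGrad Ω₁ x‖ ^ 2 + ‖graphTrace Ω₁ x‖ ^ 2)) := by gcongr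
      _ = _ := by ring
  have h4 := mul_le_mul_of_nonneg_left hbdry hγ.le
  have h5 := mul_le_mul_of_nonneg_left hval hbmax
  have h6 : (lo * min 1 γ - bmax * CF) / CF * ‖graphFun Ω₁ x‖ ^ 2
      = lo * min 1 γ / CF * ‖graphFun Ω₁ x‖ ^ 2 - bmax * ‖graphFun Ω₁ x‖ ^ 2 := by
    have := hCF.1.ne'
    field_simp
  rw [sub_apply, inner_sub_left, inner_robinOp', h6]
  linarith

theorem norm_graphTrace_le {C : ℝ} (hC : IsTraceConst Ω₁ C) (x : traceGraph Ω₁) :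
    ‖graphTrace Ω₁ x‖ ≤ C * ‖graphFun Ω₁ x‖ :=
  hC.2 _ _ (isTrace_graph x)

/-- Coercivity is given only in the `H¹` norm. Since the squared graph norm is at most `(1 + C²)`
times the squared `H¹` norm, coercivity on the graph holds with `α / (1 + C²)`. -/
theorem isUnit_robinOp_sub {C α : ℝ} (hC : IsTraceConst Ω₁ C) (hα : 0 < α)
    {T : traceGraph Ω₁ →L[ℝ] traceGraph Ω₁}
    (hT : ∀ x, α * ‖graphFun Ω₁ x‖ ^ 2 ≤ inner ℝ (T x) x) : IsUnit T := by
  have hpos : 0 < 1 + C ^ 2 := by positivity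
  refine isUnit_of_coercive T (div_pos hα hpos) fun x => le_trans ?_ (hT x)
  have h1 : ‖graphTrace Ω₁ x‖ ^ 2 ≤ C ^ 2 * ‖graphFun Ω₁ x‖ ^ 2 := by
    rw [← mul_pow]
    have := norm_graphTrace_le hC x
    gcongr
  rw [div_mul_eq_mul_div, div_le_iff₀ hpos, norm_sq_graph, mul_assoc]
  refine mul_le_mul_of_nonneg_left ?_ hα.le
  linarith

/-- The boundary term is estimated by two uses of the trace inequality; this is the source of the
factor `1 + γ Ct²` in `β`. -/
theorem abs_inner_robinOp_le (hsub : Ω₁ ⊆ Ω) {γ C : ℝ} (hγ : 0 < γ) (hC : IsTraceConst Ω₁ C)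
    (h : Coef Ω Ω₁) (x y : traceGraph Ω₁) :
    |inner ℝ (robinOp hsub γ h x) y|
      ≤ (1 + γ * C ^ 2) * ‖h‖ * (‖graphFun Ω₁ x‖ * ‖graphFun Ω₁ y‖) := by
  rw [inner_robinOp']
  refine (abs_add_le _ _).trans ?_
  rw [abs_mul, abs_of_pos hγ]
  have hC0 := hC.1
  have h1 : |inner ℝ (mulL2 (E M) _ (lpMono ℝ ∞ (restrict_le_coefMeasure hsub) h)
      (graphGrad Ω₁ x)) (graphGrad Ω₁ y)| ≤ ‖h‖ * (‖graphFun Ω₁ x‖ * ‖graphFun Ω₁ y‖) := by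
    refine (abs_inner_mulL2_le _ _ _).trans ?_
    gcongr
    · exact norm_lpMono_le _ h
    · exact norm_grad_le _
    · exact norm_grad_le _
  have h2 : |inner ℝ (mulL2 ℝ _ (lpMono ℝ ∞ surf_le_coefMeasure h) (graphTrace Ω₁ x))
      (graphTrace Ω₁ y)| ≤ ‖h‖ * ((C * ‖graphFun Ω₁ x‖) * (C * ‖graphFun Ω₁ y‖)) := by
    refine (abs_inner_mulL2_le _ _ _).trans ?_
    gcongr
    · exact norm_lpMono_le _ h
    · exact norm_graphTrace_le hC x
    · exact norm_graphTrace_le hC y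
  calc _ ≤ ‖h‖ * (‖graphFun Ω₁ x‖ * ‖graphFun Ω₁ y‖)
        + γ * (‖h‖ * ((C * ‖graphFun Ω₁ x‖) * (C * ‖graphFun Ω₁ y‖))) := by gcongr
    _ = _ := by ring

theorem inner_load_le (hsub : Ω₁ ⊆ Ω) (f : Lp ℝ 2 (volume.restrict Ω)) (x : traceGraph Ω₁) :
    inner ℝ (load hsub f) x ≤ ‖f‖ * ‖graphFun Ω₁ x‖ := by
  rw [load, ContinuousLinearMap.adjoint_inner_left]
  refine (real_inner_le_norm _ _).trans ?_
  gcongr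
  · exact norm_lpMono_le _ f
  · exact norm_val_le _

/-! ### Unique differentiability on the admissible set -/

theorem convex_admissible (lo hi : ℝ) : Convex ℝ (admissible Ω Ω₁ lo hi) := by
  intro a ha c hc s t hs ht hst
  have hS := Lp.coeFn_add (s • a) (t • c)
  filter_upwards [ha, hc, hS, Lp.coeFn_smul s a, Lp.coeFn_smul t c] with x h1 h2 h3 h4 h5
  rw [h3, Pi.add_apply, h4, h5]
  exact convex_Ioo lo hi h1 h2 hs ht hst

/-- The ball around the constant midpoint, with radius half the gap, stays between the bounds. -/
theorem interior_admissible_nonempty {lo hi : ℝ} (h : lo < hi) :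
    (interior (admissible Ω Ω₁ lo hi)).Nonempty := by
  have hm : MemLp (fun _ : E M => (lo + hi) / 2) ∞ (coefMeasure Ω Ω₁) := memLp_top_const _
  refine ⟨hm.toLp, mem_interior.2
    ⟨Metric.ball hm.toLp ((hi - lo) / 2), fun a ha => ?_, Metric.isOpen_ball,
      Metric.mem_ball_self (by linarith)⟩⟩
  rw [Metric.mem_ball, dist_eq_norm] at ha
  have hbound : ∀ᵐ x ∂(coefMeasure Ω Ω₁), ‖(a - hm.toLp) x‖ ≤ ‖a - hm.toLp‖ := by
    have h1 := ae_le_eLpNormEssSup (f := ⇑(a - hm.toLp)) (μ := coefMeasure Ω Ω₁)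
    filter_upwards [h1] with x hx
    rw [← eLpNorm_exponent_top] at hx
    rw [Lp.norm_def]
    simpa using ENNReal.toReal_mono (Lp.eLpNorm_ne_top _) hx
  filter_upwards [hbound, Lp.coeFn_sub a hm.toLp, hm.coeFn_toLp] with x h1 h2 h3
  rw [h2, Pi.sub_apply, h3, Real.norm_eq_abs] at h1
  have h4 := abs_lt.1 (h1.trans_lt ha)
  constructor <;> linarith [h4.1, h4.2]

/-- The admissible set need not be open, since its members may come arbitrarily close to the bounds.
Convexity and nonempty interior suffice when `lo < hi`; otherwise the set is empty because `Ω` has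
positive measure. -/
theorem uniqueDiffOn_admissible (hΩ : IsOpen Ω) (hne : Ω.Nonempty) (lo hi : ℝ) :
    UniqueDiffOn ℝ (admissible Ω Ω₁ lo hi) := by
  rcases lt_or_ge lo hi with h | h
  · exact uniqueDiffOn_convex (convex_admissible lo hi) (interior_admissible_nonempty h)
  · intro a ha
    have hvol : ∀ᵐ x ∂(volume.restrict Ω), lo < a x ∧ a x < hi :=
      (ae_add_measure_iff.1 ha).1
    have : NeBot (ae (volume.restrict Ω)) := by
      rw [ae_neBot, Ne, Measure.restrict_eq_zero]
      exact (hΩ.measure_pos _ hne).ne'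
    obtain ⟨x, hx⟩ := hvol.exists
    exact absurd (hx.1.trans hx.2) (not_lt.2 h)

end Robin

/-! ### Identification of the solution map and a priori estimates -/

section SolutionMap

variable {M : ℕ} {Ω Ω₁ : Set (E M)}

theorem isWeakSolution_iff_eq_paramSol (hsub : Ω₁ ⊆ Ω) {γ : ℝ}
    {b f : Lp ℝ ∞ (volume.restrict Ω)} {f₂ : Lp ℝ 2 (volume.restrict Ω)}
    (hf : f₂ =ᵐ[volume.restrict Ω] f) {a : Coef Ω Ω₁}
    (ha : IsUnit (robinOp hsub γ a - massOp hsub b)) {u : H1 Ω₁} :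
    IsWeakSolution γ b f a u ↔
      u = graphFun Ω₁ (paramSol (robinOp hsub γ) (massOp hsub b) (load hsub f₂) a) := by
  rw [isWeakSolution_iff hsub hf]
  constructor
  · rintro ⟨x, rfl, hx⟩
    rw [eq_of_apply_eq ha (hx.trans (paramSol_eq ha).symm)]
  · rintro rfl
    exact ⟨_, rfl, paramSol_eq ha⟩

/-- Uniqueness removes the arbitrary choice in `solMap`. -/
theorem solMap_eq_of_iff {γ : ℝ} {b f : Lp ℝ ∞ (volume.restrict Ω)} {a : Coef Ω Ω₁} {w : H1 Ω₁}
    (h : ∀ u, IsWeakSolution γ b f a u ↔ u = w) : solMap γ b f a = w := by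
  have hex : ∃ u, IsWeakSolution γ b f a u := ⟨w, (h w).2 rfl⟩
  rw [solMap, dif_pos hex]
  exact (h _).1 hex.choose_spec

/-- Testing the equation with its own solution gives `α ‖u‖² ≤ ‖f₂‖ ‖u‖`; the case `u = 0` is
treated separately before cancelling. -/
theorem norm_graphFun_paramSol_le (hsub : Ω₁ ⊆ Ω) {γ α : ℝ} (hα : 0 < α)
    {b : Lp ℝ ∞ (volume.restrict Ω)} {f₂ : Lp ℝ 2 (volume.restrict Ω)} {a : Coef Ω Ω₁}
    (ha : IsUnit (robinOp hsub γ a - massOp hsub b))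
    (hT : ∀ x, α * ‖graphFun Ω₁ x‖ ^ 2 ≤ inner ℝ ((robinOp hsub γ a - massOp hsub b) x) x) :
    ‖graphFun Ω₁ (paramSol (robinOp hsub γ) (massOp hsub b) (load hsub f₂) a)‖
      ≤ ‖f₂‖ / α := by
  set x := paramSol (robinOp hsub γ) (massOp hsub b) (load hsub f₂) a with hx
  have h1 := hT x
  rw [hx, paramSol_eq ha, ← hx] at h1
  have h2 := h1.trans (inner_load_le hsub f₂ x)
  rw [le_div_iff₀ hα]
  by_contra! hlt
  have hpos : 0 < ‖graphFun Ω₁ x‖ := by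
    by_contra! h0
    have := le_antisymm h0 (norm_nonneg _)
    rw [this, zero_mul] at hlt
    exact absurd hlt (not_lt.2 (norm_nonneg _))
  nlinarith [mul_lt_mul_of_pos_right hlt hpos]

/-- The same energy argument, with `z` as test function and the continuity bound of the form for the
right-hand side. -/
theorem norm_graphFun_le_of_robinOp (hsub : Ω₁ ⊆ Ω) {γ α C : ℝ} (hγ : 0 < γ) (hα : 0 < α)
    (hC : IsTraceConst Ω₁ C) {T : traceGraph Ω₁ →L[ℝ] traceGraph Ω₁}
    (hT : ∀ x, α * ‖graphFun Ω₁ x‖ ^ 2 ≤ inner ℝ (T x) x) {h : Coef Ω Ω₁}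
    {x z : traceGraph Ω₁} (hz : T z = -(robinOp hsub γ h x)) :
    ‖graphFun Ω₁ z‖ ≤ (1 + γ * C ^ 2) * ‖h‖ * ‖graphFun Ω₁ x‖ / α := by
  have h1 := hT z
  rw [hz, inner_neg_left] at h1
  have h2 := h1.trans ((neg_le_abs _).trans (abs_inner_robinOp_le hsub hγ hC h x z))
  rw [le_div_iff₀ hα]
  by_contra! hlt
  have hpos : 0 < ‖graphFun Ω₁ z‖ := by
    by_contra! h0
    have := le_antisymm h0 (norm_nonneg _)
    rw [this, zero_mul] at hlt
    exact absurd hlt (not_lt.2 (by positivity))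
  nlinarith [mul_lt_mul_of_pos_right hlt hpos]

end SolutionMap

end RobinID

end
-- Differentiability of the coefficient-to-solution map
theorem lemma2p3 (M : ℕ) (hM : 1 ≤ M) (Ω Ω₁ : Set (RobinID.E M))
    (hΩ : IsOpen Ω) (hΩb : Bornology.IsBounded Ω)
    (hΩ₁ : IsOpen Ω₁) (hconn : IsConnected Ω₁) (hLip : RobinID.HasLipschitzBoundary Ω₁)
    (hsub : Ω₁ ⊆ Ω)
    (γ lo hi bmax CF Ct : ℝ) (hγ : 0 < γ) (hlo : 0 < lo)
    (hCF : RobinID.IsFriedrichsConst Ω₁ CF) (hCt : RobinID.IsTraceConst Ω₁ Ct)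
    (hbmax : bmax < lo * min 1 γ / CF)
    (b f : Lp ℝ ∞ (volume.restrict Ω))
    (hb : ∀ᵐ x ∂(volume.restrict Ω), 0 < b x ∧ b x < bmax) :
    let A : Set (RobinID.Coef Ω Ω₁) := RobinID.admissible Ω Ω₁ lo hi
    let U : RobinID.Coef Ω Ω₁ → RobinID.H1 Ω₁ := RobinID.solMap γ b f
    let U' : RobinID.Coef Ω Ω₁ → (RobinID.Coef Ω Ω₁ →L[ℝ] RobinID.H1 Ω₁) := fderivWithin ℝ U A
    let α : ℝ := (lo * min 1 γ - bmax * CF) / CF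
    let β : ℝ := (lo * min 1 γ - bmax * CF) / (CF * (1 + γ * Ct ^ 2))
    0 < α ∧ 0 < β ∧
    -- `U` is well defined on `A`: `U a` is the unique weak solution
    (∀ a ∈ A, RobinID.IsWeakSolution γ b f a (U a) ∧
      ∀ u, RobinID.IsWeakSolution γ b f a u → u = U a) ∧
    -- derivatives relative to `A` are unique, and `U` is continuously Fréchet differentiable on `A`
    UniqueDiffOn ℝ A ∧
    (∀ a ∈ A, HasFDerivWithinAt U (U' a) A a) ∧
    ContinuousOn U' A ∧
    -- `U' a h` is the unique weak solution of the linearized Robin problem, with the estimate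
    (∀ a ∈ A, ∀ h : RobinID.Coef Ω Ω₁,
      RobinID.IsLinearizedSolution γ b a h (U a) (U' a h) ∧
      (∀ η, RobinID.IsLinearizedSolution γ b a h (U a) η → η = U' a h) ∧
      ‖U' a h‖ ≤ 1 / (α * β) * (eLpNorm f 2 (volume.restrict Ω)).toReal * ‖h‖) := by
  open RobinID in
  intro A U U' α β
  have hne : Ω.Nonempty := hconn.nonempty.mono hsub
  have hfin : IsFiniteMeasure (volume.restrict Ω) :=
    ⟨by rw [Measure.restrict_apply_univ]; exact hΩb.measure_lt_top⟩
  have hgap : 0 < lo * min 1 γ - bmax * CF := sub_pos.2 ((lt_div_iff₀ hCF.1).1 hbmax)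
  have hk : 0 < 1 + γ * Ct ^ 2 := by positivity
  have hα : 0 < α := div_pos hgap hCF.1
  have hβ : 0 < β := div_pos hgap (mul_pos hCF.1 hk)
  have hαβ : β = α / (1 + γ * Ct ^ 2) := (div_div _ _ _).symm
  -- Since `Ω` has positive measure, some point satisfies `0 < b x < bmax`.
  have hbmax0 : 0 ≤ bmax := by
    have : NeBot (ae (volume.restrict Ω)) := by
      rw [ae_neBot, Ne, Measure.restrict_eq_zero]
      exact (hΩ.measure_pos _ hne).ne'
    obtain ⟨x, hx⟩ := hb.exists
    exact (hx.1.trans hx.2).le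
  have hbu : ∀ᵐ x ∂(volume.restrict Ω), b x ≤ bmax := hb.mono fun x hx => hx.2.le
  -- Boundedness of `Ω` enters here: on a finite measure space `L^∞` embeds in `L²`.
  have hf2 : MemLp f 2 (volume.restrict Ω) := (Lp.memLp f).mono_exponent le_top
  have hff : hf2.toLp =ᵐ[volume.restrict Ω] f := hf2.coeFn_toLp
  have hT : ∀ a ∈ A, ∀ x, α * ‖graphFun Ω₁ x‖ ^ 2
      ≤ inner ℝ ((robinOp hsub γ a - massOp hsub b) x) x := fun a ha x =>
    le_inner_robinOp_sub hsub hγ hlo hCF hbmax0 hbu ha x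
  have hunit : ∀ a ∈ A, IsUnit (robinOp hsub γ a - massOp hsub b) := fun a ha =>
    isUnit_robinOp_sub hCt hα (hT a ha)
  have hud : UniqueDiffOn ℝ A := uniqueDiffOn_admissible hΩ hne lo hi
  set S := paramSol (robinOp hsub γ) (massOp hsub b) (load hsub hf2.toLp) with hS
  have hweak : ∀ a ∈ A, ∀ u, IsWeakSolution γ b f a u ↔ u = graphFun Ω₁ (S a) := fun a ha u =>
    isWeakSolution_iff_eq_paramSol hsub hff (hunit a ha)
  have hUS : Set.EqOn U (fun a => graphFun Ω₁ (S a)) A := fun a ha =>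
    solMap_eq_of_iff (hweak a ha)
  have hSc : ∀ a ∈ A, ContDiffAt ℝ 1 S a := fun a ha => contDiffAt_paramSol (hunit a ha)
  -- `S` is differentiable in the full coefficient space at each `a ∈ A`, but `U` is identified with
  -- `graphFun Ω₁ ∘ S` only on `A`, so the derivative of `U` is taken relative to `A`.
  have hSd : ∀ a ∈ A, HasFDerivWithinAt U ((graphFun Ω₁).comp (fderiv ℝ S a)) A a :=
    fun a ha => (((graphFun Ω₁).hasFDerivAt.comp a
      ((hSc a ha).differentiableAt (by simp)).hasFDerivAt).hasFDerivWithinAt).congr hUS (hUS ha)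
  have hU' : ∀ a ∈ A, U' a = (graphFun Ω₁).comp (fderiv ℝ S a) := fun a ha =>
    (hSd a ha).fderivWithin (hud a ha)
  refine ⟨hα, hβ, fun a ha => ⟨(hweak a ha _).2 (hUS ha), fun u hu => ?_⟩, hud,
    fun a ha => ?_, ?_, fun a ha h => ?_⟩
  · rw [hUS ha]
    exact (hweak a ha u).1 hu
  · rw [hU' a ha]
    exact hSd a ha
  · refine ContinuousOn.congr (fun a ha => ?_) hU'
    exact (((ContinuousLinearMap.compL ℝ _ _ _ (graphFun Ω₁)).continuous.continuousAt).comp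
      ((hSc a ha).continuousAt_fderiv one_ne_zero)).continuousWithinAt
  · have hz := apply_fderiv_paramSol (F := load hsub hf2.toLp) (hunit a ha) h
    rw [hUS ha, hU' a ha]
    refine ⟨(isLinearizedSolution_iff hsub hCt _).2 ⟨_, rfl, hz⟩, fun η hη => ?_, ?_⟩
    · obtain ⟨z, rfl, hz'⟩ := (isLinearizedSolution_iff hsub hCt _).1 hη
      rw [eq_of_apply_eq (hunit a ha) (hz'.trans hz.symm)]
      rfl
    · have h1 : ‖graphFun Ω₁ (S a)‖ ≤ ‖hf2.toLp‖ / α :=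
        norm_graphFun_paramSol_le hsub hα (hunit a ha) (hT a ha)
      have h2 := norm_graphFun_le_of_robinOp hsub hγ hα hCt (hT a ha) hz
      rw [← Lp.norm_toLp f hf2, hαβ]
      refine h2.trans ?_
      calc _ ≤ (1 + γ * Ct ^ 2) * ‖h‖ * (‖hf2.toLp‖ / α) / α := by gcongr
        _ = _ := by
          field_simp
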